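/- Let $\Omega=\{(x,y)\in\mathbb{R}^2: x>0\}$. For $k\in\mathbb{R}$ let $\mathfrak h(k)=-\frac{d^2}{dx^2}+(x-k)^2$ in $L^2(0,\infty)$ with a Dirichlet condition at $x=0$; let $\lambda_1(k)<\lambda_2(k)<\dots$ be its (simple) eigenvalues and $u_n(\cdot,k)$, $n\ge 1$, corresponding eigenfunctions of norm one in $L^2(0,\infty)$. Put $E_n=2n-1$; $\lambda_n$ is a decreasing real-analytic diffeomorphism of $\mathbb{R}$ onto $I_n=(E_n,\infty)$; put $\mu_n=|\lambda_n'\circ\lambda_n^{-1}|^{-1/2}$ on $I_n$. For $s>1/2$ let $L^{2,s}(\Omega)$ be the space of measurable $f:\Omega\to\mathbb{C}$ with $(1+y^2)^{s/2}f\in L^2(\Omega)$, and for $f\in L^{2,s}(\Omega)$ let $$f_n(k)=\int_0^\infty \Big(\frac1{\sqrt{2\pi}}\int_{\mathbb{R}}e^{-iky}f(x,y)\,dy\Big)\overline{u_n(x,k)}\,dx,\qquad k\in\mathbb{R}.$$ For $\alpha\ge 0$ let $\mathcal X_{n,0}^{s,\alpha}(\Omega)$ be the set of $f\in L^{2,s}(\Omega)$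 such that $\mu_n\,(f_n\circ\lambda_n^{-1})$ belongs to $L^2(I_n)$ and extends from $I_n$ to a function in $C^{0,\alpha}([E_n,\infty))$ (bounded, continuous, and Hölder continuous of exponent $\alpha$) that vanishes at $E_n$. Finally let $$w_n^\alpha(k)=|\lambda_n(k)-E_n|^{-\alpha}\,|\lambda_n'(k)|^{-1/2},\qquad k\in\mathbb{R}.$$ **Proposition.** For all integers $n\ge1$, all $s\in(1/2,\infty)$, all $\alpha\in[0,\min(1,s-1/2))$ and all $f\in\mathcal X_{n,0}^{s,\alpha}(\Omega)$, one has $w_n^\alpha f_n\in L^\infty(\mathbb{R})$; moreover there is a constant $C$ with $|w_n^\alpha(k)f_n(k)|\le C$ for every $k\in\mathbb{R}$. -/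

import Mathlib

open MeasureTheory Set
open scoped NNReal ENNReal ComplexConjugate

noncomputable section

namespace HalfPlane

/-- The half-plane `{(x, y) : x > 0}`. -/
def Omega : Set (ℝ × ℝ) := {p | 0 < p.1}

/-- The weighted space `L^{2,σ}` on the half-plane: `(1 + y²)^(σ/2) f` is square integrable. The
weight is continuous and positive, so measurability of `f` is included. -/
def weightedL2 (σ : ℝ) : Set (ℝ × ℝ → ℂ) :=
  {f | MemLp (fun p : ℝ × ℝ => (((1 + p.2 ^ 2) ^ (σ / 2) : ℝ) : ℂ) * f p) 2
    (volume.restrict Omega)}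

/-- The graph of the fiber operator `-d²/dx² + (x - k)²` in `L²(0, ∞)` with a Dirichlet condition
at `0`: `u` and `g` are in `L²(0, ∞)`, `u` and its derivative `v` are locally absolutely continuous
on `[0, ∞)`, `u 0 = 0`, and `-u'' + (x - k)² u = g` almost everywhere on `(0, ∞)`. Both absolute
continuity statements are written as integral equations, and `u` is the continuous representative
of its class. All integrands below are locally integrable on `[0, ∞)`. -/
def FiberOperator (k : ℝ) (u g : ℝ → ℂ) : Prop :=
  MemLp u 2 (volume.restrict (Ioi 0)) ∧ MemLp g 2 (volume.restrict (Ioi 0)) ∧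
    ∃ v : ℝ → ℂ,
      (∀ x, 0 ≤ x → u x = ∫ t in (0 : ℝ)..x, v t) ∧
      (∀ x, 0 ≤ x →
        v x = v 0 + ∫ t in (0 : ℝ)..x, ((((t - k) ^ 2 : ℝ) : ℂ) * u t - g t))

/-- `u` is an eigenfunction, of norm one in `L²(0, ∞)`, of the fiber operator at `k`, with
eigenvalue `lam`. -/
def IsNormalizedEigenfunction (k lam : ℝ) (u : ℝ → ℂ) : Prop :=
  FiberOperator k u (fun x => (lam : ℂ) * u x) ∧ ∫ x in Ioi (0 : ℝ), ‖u x‖ ^ 2 = 1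

/-- The set of eigenvalues of the fiber operator at `k`. -/
def eigenvalues (k : ℝ) : Set ℝ := {lam | ∃ u, IsNormalizedEigenfunction k lam u}

/-- The band function: `bandFun n k` is the `n`-th eigenvalue (`n ≥ 1`, increasing order) of the
fiber operator at `k`, that is, the least eigenvalue `lam` such that at least `n` eigenvalues are
`≤ lam`. The eigenvalues are simple, because an eigenfunction is determined by its derivative at
the origin, so no multiplicity has to be counted. -/
def bandFun (n : ℕ) (k : ℝ) : ℝ :=
  sInf {lam | lam ∈ eigenvalues k ∧ (n : ℕ∞) ≤ (eigenvalues k ∩ Iic lam).encard}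

/-- The Landau level `E_n = 2 n - 1`, the limit of the `n`-th band function at `+∞`. -/
def landau (n : ℕ) : ℝ := 2 * (n : ℝ) - 1

/-- A choice `u n x k` of normalized eigenfunctions, `u n · k` belonging to the `n`-th eigenvalue
of the fiber operator at `k`. -/
def IsEigenfunctionFamily (u : ℕ → ℝ → ℝ → ℂ) : Prop :=
  ∀ n, 1 ≤ n → ∀ k, IsNormalizedEigenfunction k (bandFun n k) (fun x => u n x k)

/-- The unitary partial Fourier transform in the longitudinal variable `y`. For `f` in
`weightedL2 s` with `s > 1/2`, `f (x, ·)` is integrable for almost every `x > 0`, so this integral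
is an honest one, for every `k`. -/
def partialFourier (f : ℝ × ℝ → ℂ) (x k : ℝ) : ℂ :=
  ((Real.sqrt (2 * Real.pi))⁻¹ : ℂ) * ∫ y : ℝ, Complex.exp (-(Complex.I * k * y)) * f (x, y)

/-- The `n`-th Fourier coefficient `f_n` of `f`. -/
def fourierCoefficient (u : ℕ → ℝ → ℝ → ℂ) (n : ℕ) (f : ℝ × ℝ → ℂ) (k : ℝ) : ℂ :=
  ∫ x in Ioi (0 : ℝ), partialFourier f x k * conj (u n x k)

/-- The inverse function of `bandFun n`, which is a bijection from `ℝ` onto `(E_n, ∞)`. -/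
def bandInv (n : ℕ) : ℝ → ℝ := Function.invFun (bandFun n)

/-- The weight `μ_n = |λ_n' ∘ λ_n⁻¹|^(-1/2)` on `(E_n, ∞)`. -/
def muWeight (n : ℕ) (lam : ℝ) : ℝ := |deriv (bandFun n) (bandInv n lam)| ^ (-(1 / 2) : ℝ)

/-- The space `C^{0,α}(S)` of bounded, continuous, `α`-Hölder continuous functions on `S`. -/
def IsHolderSpace (α : ℝ) (S : Set ℝ) (g : ℝ → ℂ) : Prop :=
  ContinuousOn g S ∧ (∃ M : ℝ, ∀ x ∈ S, ‖g x‖ ≤ M) ∧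
    ∃ C : ℝ≥0, HolderOnWith C α.toNNReal g S

/-- `μ_n (f_n ∘ λ_n⁻¹)`, a function on `(E_n, ∞)`. -/
def weightedCoefficient (u : ℕ → ℝ → ℝ → ℂ) (n : ℕ) (f : ℝ × ℝ → ℂ) (lam : ℝ) : ℂ :=
  (muWeight n lam : ℂ) * fourierCoefficient u n f (bandInv n lam)

/-- The absorption space `X_{n,0}^{s,α}`: the `f` in `L^{2,s}` such that `μ_n (f_n ∘ λ_n⁻¹)` is
in `L²(E_n, ∞)` and extends from `(E_n, ∞)` to a function in `C^{0,α}([E_n, ∞))` that vanishes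
at `E_n`. -/
def absorptionSpace (u : ℕ → ℝ → ℝ → ℂ) (n : ℕ) (s α : ℝ) : Set (ℝ × ℝ → ℂ) :=
  {f | f ∈ weightedL2 s ∧
    MemLp (weightedCoefficient u n f) 2 (volume.restrict (Ioi (landau n))) ∧
    ∃ g : ℝ → ℂ, (∀ lam ∈ Ioi (landau n), g lam = weightedCoefficient u n f lam) ∧
      IsHolderSpace α (Ici (landau n)) g ∧ g (landau n) = 0}

/-- The weight `w_n^α(k) = |λ_n(k) - E_n|^(-α) |λ_n'(k)|^(-1/2)`. -/
def wWeight (n : ℕ) (α k : ℝ) : ℝ :=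
  |bandFun n k - landau n| ^ (-α) * |deriv (bandFun n) k| ^ (-(1 / 2) : ℝ)

end HalfPlane

end

namespace HalfPlane

/-- `θ` is a Prüfer angle of the equation `-φ'' + x² φ = lam φ`. -/
def IsPhase (lam : ℝ) (θ : ℝ → ℝ) : Prop :=
  ∀ x, HasDerivAt θ (1 + (lam - x ^ 2 - 1) * Real.sin (θ x) ^ 2) x

theorem sin_sq_sub_sin_sq (s t : ℝ) :
    Real.sin s ^ 2 - Real.sin t ^ 2 = Real.sin (s - t) * Real.sin (s + t) := by
  rw [Real.sin_sub, Real.sin_add]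
  have h1 := Real.sin_sq_add_cos_sq s
  have h2 := Real.sin_sq_add_cos_sq t
  linear_combination Real.sin t ^ 2 * h1 - Real.sin s ^ 2 * h2

theorem abs_sin_sq_sub_sin_sq_le (s t : ℝ) :
    |Real.sin s ^ 2 - Real.sin t ^ 2| ≤ |s - t| := by
  rw [sin_sq_sub_sin_sq, abs_mul]
  calc |Real.sin (s - t)| * |Real.sin (s + t)| ≤ |s - t| * 1 :=
        mul_le_mul Real.abs_sin_le_abs (Real.abs_sin_le_one _) (abs_nonneg _) (abs_nonneg _)
    _ = |s - t| := mul_one _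

theorem lipschitzWith_phase_field {K : ℝ≥0} {c : ℝ} (hc : |c| ≤ K) :
    LipschitzWith K (fun s : ℝ => 1 + c * Real.sin s ^ 2) := by
  refine LipschitzWith.of_dist_le_mul fun s t => ?_
  rw [Real.dist_eq, Real.dist_eq]
  calc |1 + c * Real.sin s ^ 2 - (1 + c * Real.sin t ^ 2)|
      = |c| * |Real.sin s ^ 2 - Real.sin t ^ 2| := by rw [← abs_mul]; congr 1; ring
    _ ≤ K * |s - t| := mul_le_mul hc (abs_sin_sq_sub_sin_sq_le s t) (abs_nonneg _) K.2

theorem abs_phase_coeff_le {lam b N x : ℝ} (hx : x ∈ Icc (b - N) (b + N)) :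
    |lam - x ^ 2 - 1| ≤ |lam| + (|b| + N) ^ 2 + 1 := by
  have hN : |x| ≤ |b| + N := by
    have := abs_le.1 (le_refl |b|)
    exact abs_le.2 ⟨by linarith [hx.1], by linarith [hx.2]⟩
  have h2 : x ^ 2 ≤ (|b| + N) ^ 2 := by
    rw [← sq_abs x]; gcongr
  have := abs_le.1 (le_refl |lam|)
  rw [abs_le]
  constructor <;> nlinarith [sq_nonneg x]

theorem exists_local_phase (lam b y N : ℝ) (hN : 0 ≤ N) :
    ∃ θ : ℝ → ℝ, θ b = y ∧ ∀ x ∈ Ioo (b - N) (b + N),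
      HasDerivAt θ (1 + (lam - x ^ 2 - 1) * Real.sin (θ x) ^ 2) x := by
  set C : ℝ := |lam| + (|b| + N) ^ 2 + 1 with hC
  have hC0 : 0 ≤ C := by positivity
  have hpl : IsPicardLindelof (fun x s : ℝ => 1 + (lam - x ^ 2 - 1) * Real.sin s ^ 2)
      (tmin := b - N) (tmax := b + N) ⟨b, by constructor <;> linarith⟩ y
      (⟨1 + C, by linarith⟩ * ⟨N, hN⟩) 0 ⟨1 + C, by linarith⟩ ⟨C, hC0⟩ := by
    refine ⟨fun t ht => ?_, fun s _ => by fun_prop, fun t ht s _ => ?_, ?_⟩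
    · exact (lipschitzWith_phase_field (abs_phase_coeff_le ht)).lipschitzOnWith
    · calc ‖1 + (lam - t ^ 2 - 1) * Real.sin s ^ 2‖
          ≤ ‖(1 : ℝ)‖ + ‖(lam - t ^ 2 - 1) * Real.sin s ^ 2‖ := norm_add_le _ _
        _ ≤ 1 + C * 1 := by
          rw [norm_one, norm_mul]
          gcongr
          · exact abs_phase_coeff_le ht
          · rw [Real.norm_eq_abs, abs_of_nonneg (sq_nonneg _)]
            exact Real.sin_sq_le_one s
        _ = 1 + C := by ring
    · simp; rfl
  obtain ⟨θ, h0, hθ⟩ := hpl.exists_eq_forall_mem_Icc_hasDerivWithinAt₀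
  exact ⟨θ, h0, fun x hx => (hθ x (Ioo_subset_Icc_self hx)).hasDerivAt (Icc_mem_nhds hx.1 hx.2)⟩

theorem exists_isPhase (lam b y : ℝ) : ∃ θ : ℝ → ℝ, θ b = y ∧ IsPhase lam θ := by
  choose! θ h0 hθ using fun N => exists_local_phase lam b y N
  have key : ∀ N M : ℝ, 0 < N → N ≤ M → EqOn (θ N) (θ M) (Ioo (b - N) (b + N)) := by
    intro N M hN hNM
    have hK : (0 : ℝ) ≤ |lam| + (|b| + N) ^ 2 + 1 := by positivity
    refine ODE_solution_unique_of_mem_Ioo (t₀ := b) (K := ⟨_, hK⟩) (s := fun _ => univ)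
      (v := fun x s : ℝ => 1 + (lam - x ^ 2 - 1) * Real.sin s ^ 2)
      (fun t ht => (lipschitzWith_phase_field
        (abs_phase_coeff_le (Ioo_subset_Icc_self ht))).lipschitzOnWith)
      ⟨by linarith, by linarith⟩ (fun t ht => ⟨hθ N hN.le t ht, trivial⟩)
      (fun t ht => ⟨hθ M (hN.le.trans hNM) t ⟨by linarith [ht.1], by linarith [ht.2]⟩, trivial⟩) ?_
    rw [h0 N hN.le, h0 M (hN.le.trans hNM)]
  refine ⟨fun x => θ (|x - b| + 1) x, h0 _ (by positivity), fun x => ?_⟩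
  have hpos : 0 < |x - b| + 2 := by positivity
  have hmem : x ∈ Ioo (b - (|x - b| + 1)) (b + (|x - b| + 1)) := by
    have := abs_le.1 (le_refl |x - b|)
    constructor <;> linarith [this.1, this.2]
  have hd := hθ (|x - b| + 2) hpos.le x ⟨by linarith [hmem.1], by linarith [hmem.2]⟩
  have hx : θ (|x - b| + 1) x = θ (|x - b| + 2) x :=
    key _ _ (by positivity) (by linarith) hmem
  simp only [hx]
  refine hd.congr_of_eventuallyEq ?_
  filter_upwards [Metric.ball_mem_nhds x one_pos] with z hz
  rw [Metric.mem_ball, Real.dist_eq] at hz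
  have hz1 : |z - b| ≤ |z - x| + |x - b| := abs_sub_le z x b
  have := abs_le.1 (le_refl |z - b|)
  exact key _ _ (by positivity) (by linarith)
    ⟨by linarith [this.1], by linarith [this.2]⟩

/-- The Prüfer angle vanishing at `b`. -/
noncomputable def phase (b lam : ℝ) : ℝ → ℝ := (exists_isPhase lam b 0).choose

theorem phase_self (b lam : ℝ) : phase b lam b = 0 := (exists_isPhase lam b 0).choose_spec.1

theorem isPhase_phase (b lam : ℝ) : IsPhase lam (phase b lam) :=
  (exists_isPhase lam b 0).choose_spec.2

theorem IsPhase.continuous {lam : ℝ} {θ : ℝ → ℝ} (h : IsPhase lam θ) : Continuous θ :=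
  continuous_iff_continuousAt.2 fun x => (h x).continuousAt

theorem IsPhase.exists_monotone {l₁ l₂ : ℝ} {α β : ℝ → ℝ} (hα : IsPhase l₁ α)
    (hβ : IsPhase l₂ β) (hl : l₁ ≤ l₂) :
    ∃ M : ℝ → ℝ, Monotone fun x => (β x - α x) * Real.exp (-M x) := by
  have hαc := hα.continuous
  have hβc := hβ.continuous
  let m : ℝ → ℝ := fun x => (l₁ - x ^ 2 - 1) * Real.sin (β x + α x) * Real.sinc (β x - α x)
  have hm : Continuous m := by
    have := Real.continuous_sinc
    fun_prop
  have hM : ∀ x, HasDerivAt (fun x => ∫ t in (0 : ℝ)..x, m t) (m x) x := fun x =>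
    intervalIntegral.integral_hasDerivAt_right (hm.intervalIntegrable _ _)
      (hm.stronglyMeasurableAtFilter _ _) hm.continuousAt
  refine ⟨fun x => ∫ t in (0 : ℝ)..x, m t, ?_⟩
  have hd := fun x => ((hβ x).fun_sub (hα x)).fun_mul (hM x).fun_neg.exp
  refine monotone_of_hasDerivAt_nonneg hd fun x => ?_
  have hs : Real.sinc (β x - α x) * (β x - α x) = Real.sin (β x - α x) := by
    by_cases h : β x - α x = 0
    · simp [h]
    · rw [Real.sinc_of_ne_zero h, div_mul_cancel₀ _ h]
  have h2 := sin_sq_sub_sin_sq (β x) (α x)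
  have : (1 + (l₂ - x ^ 2 - 1) * Real.sin (β x) ^ 2
        - (1 + (l₁ - x ^ 2 - 1) * Real.sin (α x) ^ 2))
        * Real.exp (-∫ t in (0 : ℝ)..x, m t)
      + (β x - α x) * (Real.exp (-∫ t in (0 : ℝ)..x, m t) * -m x)
      = (l₂ - l₁) * Real.sin (β x) ^ 2 * Real.exp (-∫ t in (0 : ℝ)..x, m t) := by
    simp only [m] at *
    linear_combination (l₁ - x ^ 2 - 1) * Real.exp (-∫ t in (0 : ℝ)..x, m t) * h2
      - (l₁ - x ^ 2 - 1) * Real.sin (β x + α x) * Real.exp (-∫ t in (0 : ℝ)..x, m t) * hs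
  simp only [Pi.zero_apply]
  rw [this]
  have := sub_nonneg.2 hl
  positivity

theorem IsPhase.le_of_le {l₁ l₂ : ℝ} {α β : ℝ → ℝ} (hα : IsPhase l₁ α) (hβ : IsPhase l₂ β)
    (hl : l₁ ≤ l₂) {a x : ℝ} (ha : α a ≤ β a) (hx : a ≤ x) : α x ≤ β x := by
  obtain ⟨M, hM⟩ := hα.exists_monotone hβ hl
  have h1 : 0 ≤ (β a - α a) * Real.exp (-M a) :=
    mul_nonneg (sub_nonneg.2 ha) (Real.exp_pos _).le
  exact sub_nonneg.1 (nonneg_of_mul_nonneg_left (h1.trans (hM hx)) (Real.exp_pos _))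

theorem IsPhase.lt_of_lt {l₁ l₂ : ℝ} {α β : ℝ → ℝ} (hα : IsPhase l₁ α) (hβ : IsPhase l₂ β)
    (hl : l₁ ≤ l₂) {a x : ℝ} (ha : α a < β a) (hx : a ≤ x) : α x < β x := by
  obtain ⟨M, hM⟩ := hα.exists_monotone hβ hl
  have h1 : 0 < (β a - α a) * Real.exp (-M a) :=
    mul_pos (sub_pos.2 ha) (Real.exp_pos _)
  exact sub_pos.1 (pos_of_mul_pos_left (h1.trans_le (hM hx)) (Real.exp_pos _).le)

theorem exists_phase_lt_phase {b l₁ l₂ : ℝ} (hl : l₁ < l₂) :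
    ∃ x, b ≤ x ∧ phase b l₁ x < phase b l₂ x := by
  by_contra! h
  have heq : ∀ x, b ≤ x → phase b l₁ x = phase b l₂ x := fun x hx =>
    ((isPhase_phase b l₁).le_of_le (isPhase_phase b l₂) hl.le
      (by rw [phase_self, phase_self]) hx).antisymm (h x hx)
  have hsin : ∀ x ∈ Ioi b, Real.sin (phase b l₁ x) = 0 := by
    intro x hx
    have h1 := isPhase_phase b l₁ x
    have h2 := isPhase_phase b l₂ x
    have hev : phase b l₁ =ᶠ[nhds x] phase b l₂ := by
      filter_upwards [Ioi_mem_nhds hx] with z hz using heq z (le_of_lt hz)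
    have h3 := h1.unique (h2.congr_of_eventuallyEq hev)
    rw [← heq x (le_of_lt hx)] at h3
    have h4 : (l₂ - l₁) * Real.sin (phase b l₁ x) ^ 2 = 0 := by linear_combination -h3
    rcases mul_eq_zero.1 h4 with h5 | h5
    · linarith
    · exact pow_eq_zero_iff (two_ne_zero) |>.1 h5
  have hx : b + 1 ∈ Ioi b := by simp
  have h1 := isPhase_phase b l₁ (b + 1)
  have hs := h1.sin
  have hev : (fun x => Real.sin (phase b l₁ x)) =ᶠ[nhds (b + 1)] fun _ => 0 := by
    filter_upwards [Ioi_mem_nhds hx] with z hz using hsin z hz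
  have h3 := hs.unique ((hasDerivAt_const (b + 1) (0 : ℝ)).congr_of_eventuallyEq hev)
  rw [hsin _ hx] at h3
  have h4 := Real.sin_sq_add_cos_sq (phase b l₁ (b + 1))
  rw [hsin _ hx] at h4
  have h5 : Real.cos (phase b l₁ (b + 1)) = 0 := by simpa using h3
  rw [h5] at h4
  norm_num at h4

theorem continuous_phase_param {b x : ℝ} (hx : b ≤ x) : Continuous fun lam => phase b lam x := by
  refine continuous_iff_continuousAt.2 fun lam => ?_
  have hK : (0 : ℝ) ≤ |lam| + (|b| + (x - b)) ^ 2 + 1 := by positivity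
  have key : ∀ l, dist (phase b l x) (phase b lam x) ≤
      gronwallBound 0 (|lam| + (|b| + (x - b)) ^ 2 + 1) (|l - lam| + 0) (x - b) := by
    intro l
    refine dist_le_of_approx_trajectories_ODE_of_mem (K := ⟨_, hK⟩) (a := b) (b := x)
      (v := fun t s : ℝ => 1 + (lam - t ^ 2 - 1) * Real.sin s ^ 2) (s := fun _ => univ)
      (fun t ht => (lipschitzWith_phase_field
        (abs_phase_coeff_le ⟨by linarith [ht.1], by linarith [ht.2]⟩)).lipschitzOnWith)
      (isPhase_phase b l).continuous.continuousOn
      (fun t _ => (isPhase_phase b l t).hasDerivWithinAt) (fun t _ => ?_) (fun _ _ => trivial)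
      (isPhase_phase b lam).continuous.continuousOn
      (fun t _ => (isPhase_phase b lam t).hasDerivWithinAt) (fun t _ => by simp)
      (fun _ _ => trivial) (by simp [phase_self]) x ⟨hx, le_rfl⟩
    rw [Real.dist_eq]
    have : 1 + (l - t ^ 2 - 1) * Real.sin (phase b l t) ^ 2 -
        (1 + (lam - t ^ 2 - 1) * Real.sin (phase b l t) ^ 2)
        = (l - lam) * Real.sin (phase b l t) ^ 2 := by ring
    rw [this, abs_mul, abs_of_nonneg (sq_nonneg (Real.sin _))]
    exact mul_le_of_le_one_right (abs_nonneg _) (Real.sin_sq_le_one _)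
  rw [ContinuousAt, tendsto_iff_dist_tendsto_zero]
  refine squeeze_zero (fun _ => dist_nonneg) key ?_
  have hc : Continuous fun l => gronwallBound 0 (|lam| + (|b| + (x - b)) ^ 2 + 1)
      (|l - lam| + 0) (x - b) :=
    (gronwallBound_continuous_ε _ _ _).comp (by fun_prop)
  have := hc.tendsto lam
  simpa [gronwallBound_ε0_δ0] using this

theorem lt_of_hasDerivAt_of_barrier {f f' : ℝ → ℝ} {a x c : ℝ} (hf : ∀ x, HasDerivAt f (f' x) x)
    (ha : c ≤ f a) (hb : ∀ x, a ≤ x → f x = c → 0 < f' x) (hx : a < x) : c < f x := by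
  have hle : ∀ y, a ≤ y → c ≤ f y := by
    intro y hy
    have := image_le_of_deriv_right_lt_deriv_boundary' (f := fun _ => c) (f' := fun _ => 0)
      (a := a) (b := y) (B := f) (B' := f') continuousOn_const
      (fun z _ => hasDerivWithinAt_const _ _ _) ha
      (fun z _ => (hf z).continuousAt.continuousWithinAt)
      (fun z _ => (hf z).hasDerivWithinAt) (fun z hz h => hb z hz.1 h.symm)
    exact this ⟨hy, le_rfl⟩
  refine (hle x hx.le).lt_of_ne fun heq => ?_
  have hpos := hb x hx.le heq.symm
  have hslope := (hasDerivAt_iff_tendsto_slope_left_right.1 (hf x)).1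
  have h1 : ∀ᶠ z in nhdsWithin x (Iio x), 0 < slope f x z := hslope.eventually_const_lt hpos
  have h2 : ∀ᶠ z in nhdsWithin x (Iio x), z ∈ Ioo a x := Ioo_mem_nhdsLT hx
  obtain ⟨z, hz1, hz2⟩ := (h1.and h2).exists
  rw [slope_def_field, ← heq] at hz1
  have h3 := hle z hz2.1.le
  have h4 : (f z - c) / (z - x) ≤ 0 :=
    div_nonpos_of_nonneg_of_nonpos (by linarith) (by linarith [hz2.2])
  linarith

theorem sin_sq_int_mul_pi_add_half (j : ℤ) : Real.sin (j * Real.pi + Real.pi / 2) ^ 2 = 1 := by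
  rw [Real.sin_add_pi_div_two, Real.cos_sq', Real.sin_int_mul_pi]
  simp

theorem IsPhase.lt_of_int_mul_pi_le {lam : ℝ} {θ : ℝ → ℝ} (h : IsPhase lam θ) {j : ℤ} {a x : ℝ}
    (ha : j * Real.pi ≤ θ a) (hx : a < x) : j * Real.pi < θ x :=
  lt_of_hasDerivAt_of_barrier h ha
    (fun y _ hy => by simp [hy, Real.sin_int_mul_pi]) hx

theorem IsPhase.lt_of_le_add_half {lam : ℝ} {θ : ℝ → ℝ} (h : IsPhase lam θ) {j : ℤ} {a x : ℝ}
    (hlam : ∀ y, a ≤ y → lam < y ^ 2) (ha : θ a ≤ j * Real.pi + Real.pi / 2) (hx : a < x) :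
    θ x < j * Real.pi + Real.pi / 2 := by
  have := lt_of_hasDerivAt_of_barrier (f := fun x => -θ x) (c := -(j * Real.pi + Real.pi / 2))
    (fun x => (h x).fun_neg) (neg_le_neg ha) (fun y hy hy2 => by
      rw [neg_inj] at hy2
      rw [hy2, sin_sq_int_mul_pi_add_half]
      linarith [hlam y hy]) hx
  exact neg_lt_neg_iff.1 this

theorem phase_pos {b lam x : ℝ} (hx : b < x) : 0 < phase b lam x := by
  simpa using (isPhase_phase b lam).lt_of_int_mul_pi_le (j := 0) (a := b)
    (by simp [phase_self]) hx

/-- The angle `θ` ends in the `n`-th decaying sector. -/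
def Decays (θ : ℝ → ℝ) (n : ℕ) : Prop :=
  ∃ X, ∀ x, X ≤ x → n * Real.pi - Real.pi / 2 ≤ θ x ∧ θ x < n * Real.pi

theorem exists_forall_lt_sq (lam b : ℝ) : ∃ X, b ≤ X ∧ 0 ≤ X ∧ ∀ x, X ≤ x → lam < x ^ 2 := by
  refine ⟨|b| + |lam| + 1, ?_, by positivity, fun x hx => ?_⟩
  · linarith [le_abs_self b, abs_nonneg lam]
  · have := le_abs_self lam
    nlinarith [abs_nonneg b, abs_nonneg lam]

theorem IsPhase.not_forall_band {l₁ l₂ : ℝ} {α β : ℝ → ℝ} (hα : IsPhase l₁ α)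
    (hβ : IsPhase l₂ β) (hl : l₁ ≤ l₂) {c X : ℝ} (hc : ∀ s, Real.sin (s - c) ^ 2 = Real.sin s ^ 2)
    (hband : ∀ x, X ≤ x → c + Real.pi / 2 ≤ α x ∧ α x < β x ∧ β x < c + Real.pi) : False := by
  have hsα : ∀ x, X ≤ x → 0 < Real.sin (α x - c) := fun x hx =>
    Real.sin_pos_of_pos_of_lt_pi (by linarith [hband x hx, Real.pi_pos]) (by linarith [hband x hx])
  have hsβ : ∀ x, X ≤ x → 0 < Real.sin (β x - c) := fun x hx =>
    Real.sin_pos_of_pos_of_lt_pi (by linarith [hband x hx, Real.pi_pos]) (by linarith [hband x hx])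
  have hcα : ∀ x, X ≤ x → Real.cos (α x - c) ≤ 0 := fun x hx =>
    Real.cos_nonpos_of_pi_div_two_le_of_le (by linarith [hband x hx])
      (by linarith [hband x hx, Real.pi_pos])
  have hcot : ∀ (l : ℝ) (γ : ℝ → ℝ), IsPhase l γ → ∀ x, Real.sin (γ x - c) ≠ 0 →
      HasDerivAt (fun x => Real.cos (γ x - c) / Real.sin (γ x - c))
        (x ^ 2 - l - (Real.cos (γ x - c) / Real.sin (γ x - c)) ^ 2) x := by
    intro l γ hγ x hs
    have h1 := (hγ x).sub_const c
    have h2 := h1.cos.fun_div h1.sin hs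
    refine h2.congr_deriv ?_
    rw [← hc]
    field_simp
    linear_combination (l - x ^ 2 - 1) * Real.sin (γ x - c) ^ 2 *
      Real.sin_sq_add_cos_sq (γ x - c) * (-1)
  set w : ℝ → ℝ := fun x => Real.cos (α x - c) / Real.sin (α x - c) with hw
  set z : ℝ → ℝ := fun x => Real.cos (β x - c) / Real.sin (β x - c) with hz
  have hδ : ∀ x, X ≤ x → 0 < w x - z x := by
    intro x hx
    have : w x - z x = Real.sin (β x - α x) / (Real.sin (α x - c) * Real.sin (β x - c)) := by
      have e : β x - α x = (β x - c) - (α x - c) := by ring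
      have n1 := (hsα x hx).ne'
      have n2 := (hsβ x hx).ne'
      rw [hw, hz, e, Real.sin_sub (β x - c) (α x - c)]
      field_simp
    rw [this]
    refine div_pos (Real.sin_pos_of_pos_of_lt_pi ?_ ?_) (mul_pos (hsα x hx) (hsβ x hx)) <;>
      linarith [hband x hx, Real.pi_pos]
  have hw0 : ∀ x, X ≤ x → w x ≤ 0 := fun x hx =>
    div_nonpos_of_nonpos_of_nonneg (hcα x hx) (hsα x hx).le
  have hder : ∀ x, X ≤ x → HasDerivAt (fun x => (w x - z x)⁻¹ + x)
      (-((x ^ 2 - l₁ - w x ^ 2) - (x ^ 2 - l₂ - z x ^ 2)) / (w x - z x) ^ 2 + 1) x := by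
    intro x hx
    exact (((hcot l₁ α hα x (hsα x hx).ne').fun_sub (hcot l₂ β hβ x (hsβ x hx).ne')).fun_inv
      (hδ x hx).ne').fun_add (hasDerivAt_id x)
  have hanti : AntitoneOn (fun x => (w x - z x)⁻¹ + x) (Ici X) := by
    refine antitoneOn_of_deriv_nonpos (convex_Ici X)
      (fun x hx => (hder x hx).continuousAt.continuousWithinAt)
      (fun x hx => (hder x (interior_subset hx)).differentiableAt.differentiableWithinAt)
      fun x hx => ?_
    have hx' : X ≤ x := interior_subset hx
    rw [(hder x hx').deriv]
    have h1 := hδ x hx'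
    have h2 := hw0 x hx'
    have : 1 ≤ ((x ^ 2 - l₁ - w x ^ 2) - (x ^ 2 - l₂ - z x ^ 2)) / (w x - z x) ^ 2 := by
      rw [one_le_div (by positivity)]
      nlinarith
    rw [neg_div]
    linarith
  have hX : X ≤ X + (w X - z X)⁻¹ := by
    have := inv_pos.2 (hδ X le_rfl)
    linarith
  have h1 := hanti (mem_Ici.2 le_rfl) (mem_Ici.2 hX) hX
  have h2 := inv_pos.2 (hδ _ hX)
  simp only at h1
  linarith

theorem sin_sq_sub_int_mul_pi (s : ℝ) (j : ℤ) :
    Real.sin (s - j * Real.pi) ^ 2 = Real.sin s ^ 2 := by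
  have h1 := Real.cos_sq_add_sin_sq (j * Real.pi)
  rw [Real.sin_sub, Real.sin_int_mul_pi]
  rw [Real.sin_int_mul_pi] at h1
  linear_combination Real.sin s ^ 2 * h1

/-- A solution ending in a decaying sector is unstable: any larger angle leaves the sector. -/
theorem Decays.exists_le_of_lt {l₁ l₂ : ℝ} {α β : ℝ → ℝ} {n : ℕ} (hd : Decays α n)
    (hα : IsPhase l₁ α) (hβ : IsPhase l₂ β) (hl : l₁ ≤ l₂) {a : ℝ} (ha : α a < β a) :
    ∃ x, a ≤ x ∧ n * Real.pi ≤ β x := by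
  by_contra! h
  obtain ⟨X, hX⟩ := hd
  refine hα.not_forall_band hβ hl (c := ((n - 1 : ℤ) : ℝ) * Real.pi) (X := max X a)
    (fun s => sin_sq_sub_int_mul_pi s _) fun x hx => ?_
  have h1 := hX x ((le_max_left _ _).trans hx)
  have h2 := h x ((le_max_right _ _).trans hx)
  have h3 := hα.lt_of_lt hβ hl ha ((le_max_right _ _).trans hx)
  push_cast
  exact ⟨by linarith, h3, by linarith⟩

theorem phase_decays_or (b lam : ℝ) :
    (∃ n : ℕ, 1 ≤ n ∧ Decays (phase b lam) n) ∨
    ∃ (j : ℕ) (X : ℝ), ∀ x, X ≤ x → j * Real.pi < phase b lam x ∧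
      phase b lam x ≤ j * Real.pi + Real.pi / 2 := by
  obtain ⟨X, hbX, hX0, hX⟩ := exists_forall_lt_sq lam b
  have hθ := isPhase_phase b lam
  have hpi := Real.pi_pos
  have hθ0 : 0 ≤ phase b lam X := by
    rcases hbX.eq_or_lt with h | h
    · rw [← h, phase_self]
    · exact (phase_pos h).le
  have trap : ∀ (i : ℕ) (y : ℝ), X ≤ y → i * Real.pi ≤ phase b lam y →
      phase b lam y ≤ i * Real.pi + Real.pi / 2 →
      ∃ (j : ℕ) (X : ℝ), ∀ x, X ≤ x → j * Real.pi < phase b lam x ∧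
        phase b lam x ≤ j * Real.pi + Real.pi / 2 := by
    intro i y hy h1 h2
    refine ⟨i, y + 1, fun x hx => ⟨?_, ?_⟩⟩
    · exact hθ.lt_of_int_mul_pi_le (j := (i : ℤ)) (a := y) (by simpa using h1) (by linarith)
    · exact (hθ.lt_of_le_add_half (j := (i : ℤ)) (a := y) (fun z hz => hX z (hy.trans hz))
        (by simpa using h2) (by linarith)).le
  set j : ℕ := ⌊phase b lam X / Real.pi⌋₊ with hj
  have hj1 : j * Real.pi ≤ phase b lam X := by
    rw [← le_div_iff₀ hpi]
    exact Nat.floor_le (by positivity)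
  have hj2 : phase b lam X < (j + 1) * Real.pi := by
    rw [← div_lt_iff₀ hpi]
    exact Nat.lt_floor_add_one _
  have hlow : ∀ x, X ≤ x → j * Real.pi ≤ phase b lam x := by
    intro x hx
    rcases hx.eq_or_lt with h | h
    · rwa [← h]
    · exact (hθ.lt_of_int_mul_pi_le (j := (j : ℤ)) (a := X) (by simpa using hj1) h).le
  by_cases h1 : ∃ y, X ≤ y ∧ phase b lam y ≤ j * Real.pi + Real.pi / 2
  · obtain ⟨y, hy, hy2⟩ := h1
    exact Or.inr (trap j y hy (hlow y hy) hy2)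
  by_cases h2 : ∃ y, X ≤ y ∧ (j + 1) * Real.pi ≤ phase b lam y
  · obtain ⟨y, hy, hy2⟩ := h2
    obtain ⟨z, hz, hz2⟩ := intermediate_value_Icc hy hθ.continuous.continuousOn ⟨hj2.le, hy2⟩
    refine Or.inr (trap (j + 1) z hz.1 ?_ ?_) <;> push_cast <;> rw [hz2]
    linarith
  · push Not at h1 h2
    refine Or.inl ⟨j + 1, by omega, X, fun x hx => ⟨?_, ?_⟩⟩ <;> push_cast
    · linarith [h1 x hx]
    · exact h2 x hx

/-- The values of the spectral parameter for which the angle reaches `n π`. -/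
def crossing (b : ℝ) (n : ℕ) : Set ℝ := {lam | ∃ x, b ≤ x ∧ n * Real.pi ≤ phase b lam x}

/-- The `n`-th Dirichlet eigenvalue of `-d²/dx² + x²` on `(b, ∞)`. -/
noncomputable def level (b : ℝ) (n : ℕ) : ℝ := sInf (crossing b n)

theorem mem_crossing_of_le {b l₁ l₂ : ℝ} {n : ℕ} (h : l₁ ∈ crossing b n) (hl : l₁ ≤ l₂) :
    l₂ ∈ crossing b n := by
  obtain ⟨x, hx, h⟩ := h
  exact ⟨x, hx, h.trans ((isPhase_phase b l₁).le_of_le (isPhase_phase b l₂) hl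
    (by rw [phase_self, phase_self]) hx)⟩

theorem crossing_nonempty (b : ℝ) (n : ℕ) : (crossing b n).Nonempty := by
  set N : ℝ := n * Real.pi with hN
  have hN0 : 0 ≤ N := by positivity
  refine ⟨1 + (|b| + N) ^ 2, b + N, by linarith, ?_⟩
  set lam : ℝ := 1 + (|b| + N) ^ 2 with hlam
  have := (convex_Icc b (b + N)).mul_sub_le_image_sub_of_le_deriv (C := 1) (f := phase b lam)
    (isPhase_phase b lam).continuous.continuousOn
    (fun x _ => (isPhase_phase b lam x).differentiableAt.differentiableWithinAt)
    (fun x hx => by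
      rw [(isPhase_phase b lam x).deriv]
      have hx' := interior_subset hx
      have h1 : |x| ≤ |b| + N := by
        have := abs_le.1 (le_refl |b|)
        exact abs_le.2 ⟨by linarith [hx'.1], by linarith [hx'.2]⟩
      have h2 : x ^ 2 ≤ (|b| + N) ^ 2 := by rw [← sq_abs x]; gcongr
      have : 0 ≤ lam - x ^ 2 - 1 := by linarith
      have := mul_nonneg this (sq_nonneg (Real.sin (phase b lam x)))
      linarith) b ⟨le_rfl, by linarith⟩ (b + N) ⟨by linarith, le_rfl⟩ (by linarith)
  rw [phase_self] at this
  linarith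

theorem crossing_bddBelow (b : ℝ) {n : ℕ} (hn : 1 ≤ n) : BddBelow (crossing b n) := by
  refine ⟨-1, fun lam h => ?_⟩
  by_contra! hlam
  obtain ⟨x, hx, h⟩ := h
  have hpi := Real.pi_pos
  have h1 : (1 : ℝ) ≤ n := by exact_mod_cast hn
  have h2 : phase b lam x ≤ Real.pi / 2 := by
    rcases hx.eq_or_lt with e | e
    · rw [← e, phase_self]; positivity
    · have := (isPhase_phase b lam).lt_of_le_add_half (j := 0) (a := b)
        (fun y _ => by nlinarith [sq_nonneg y]) (by rw [phase_self]; simp; positivity) e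
      simp at this
      exact this.le
  nlinarith

theorem mem_crossing_of_level_lt {b lam : ℝ} {n : ℕ} (h : level b n < lam) :
    lam ∈ crossing b n := by
  obtain ⟨l, hl, hlt⟩ := exists_lt_of_csInf_lt (crossing_nonempty b n) h
  exact mem_crossing_of_le hl hlt.le

theorem level_not_mem_crossing (b : ℝ) {n : ℕ} (hn : 1 ≤ n) : level b n ∉ crossing b n := by
  rintro ⟨x, hx, h⟩
  have h1 : n * Real.pi < phase b (level b n) (x + 1) := by
    simpa using (isPhase_phase b (level b n)).lt_of_int_mul_pi_le (j := (n : ℤ)) (a := x)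
      (x := x + 1) (by simpa using h) (by linarith)
  have hc := (continuous_phase_param (b := b) (x := x + 1) (by linarith)).continuousAt
    (x := level b n)
  have h2 : ∀ᶠ l in nhdsWithin (level b n) (Iio (level b n)), n * Real.pi < phase b l (x + 1) :=
    nhdsWithin_le_nhds (hc.eventually_const_lt h1)
  obtain ⟨l, hl, hl2⟩ := (h2.and self_mem_nhdsWithin).exists
  exact absurd (csInf_le (crossing_bddBelow b hn) ⟨x + 1, by linarith, hl.le⟩) (not_le.2 hl2)

theorem level_decays (b : ℝ) {n : ℕ} (hn : 1 ≤ n) : Decays (phase b (level b n)) n := by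
  set a := level b n with ha
  have hpi := Real.pi_pos
  obtain ⟨X, hbX, hX0, hX⟩ := exists_forall_lt_sq (a + 1) b
  refine ⟨X, fun x hx => ⟨?_, ?_⟩⟩
  · by_contra! hlt
    have hbx := hbX.trans hx
    have hc := (continuous_phase_param (b := b) (x := x) hbx).continuousAt (x := a)
    have h1 : ∀ᶠ l in nhdsWithin a (Ioi a), phase b l x < n * Real.pi - Real.pi / 2 :=
      nhdsWithin_le_nhds (hc.eventually_lt_const hlt)
    have h2 : ∀ᶠ l in nhdsWithin a (Ioi a), l ∈ Ioo a (a + 1) := Ioo_mem_nhdsGT (by linarith)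
    obtain ⟨l, hl, hl2⟩ := (h1.and h2).exists
    obtain ⟨y, hy, hny⟩ := mem_crossing_of_level_lt (n := n) hl2.1
    have hθ := isPhase_phase b l
    rcases lt_or_ge y x with hyx | hyx
    · have := hθ.lt_of_int_mul_pi_le (j := (n : ℤ)) (a := y) (by simpa using hny) hyx
      push_cast at this
      linarith
    · rcases hyx.eq_or_lt with e | e
      · rw [← e] at hny; linarith
      · have := hθ.lt_of_le_add_half (j := (n : ℤ) - 1) (a := x)
          (fun z hz => by linarith [hX z (hx.trans hz), hl2.2]) (by push_cast; linarith) e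
        push_cast at this
        linarith
  · by_contra! hge
    exact level_not_mem_crossing b hn ⟨x, hbX.trans hx, hge⟩

theorem eq_level_of_decays {b lam : ℝ} {n : ℕ} (hn : 1 ≤ n) (h : Decays (phase b lam) n) :
    lam = level b n := by
  have hnot : lam ∉ crossing b n := by
    rintro ⟨x, hx, hnx⟩
    obtain ⟨X, hX⟩ := h
    have h1 := (isPhase_phase b lam).lt_of_int_mul_pi_le (j := (n : ℤ)) (a := x)
      (x := max X (x + 1)) (by simpa using hnx) (by
        exact lt_of_lt_of_le (by linarith) (le_max_right _ _))
    have h2 := (hX _ (le_max_left X (x + 1))).2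
    push_cast at h1
    linarith
  apply le_antisymm
  · refine le_csInf (crossing_nonempty b n) fun l hl => ?_
    by_contra! hlt
    exact hnot (mem_crossing_of_le hl hlt.le)
  · refine le_of_forall_gt_imp_ge_of_dense fun l hl => ?_
    obtain ⟨x, hx, hlt⟩ := exists_phase_lt_phase (b := b) hl
    obtain ⟨y, hy, h'⟩ := h.exists_le_of_lt (isPhase_phase b lam) (isPhase_phase b l) hl.le hlt
    exact csInf_le (crossing_bddBelow b hn) ⟨y, hx.trans hy, h'⟩

theorem level_lt_level_succ (b : ℝ) {n : ℕ} (hn : 1 ≤ n) : level b n < level b (n + 1) := by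
  have hpi := Real.pi_pos
  refine lt_of_le_of_ne (csInf_le_csInf (crossing_bddBelow b hn) (crossing_nonempty b _) ?_) ?_
  · rintro l ⟨x, hx, h⟩
    refine ⟨x, hx, le_trans ?_ h⟩
    push_cast
    nlinarith
  · intro heq
    obtain ⟨X, hX⟩ := level_decays b hn
    obtain ⟨Y, hY⟩ := level_decays b (n := n + 1) (by omega)
    rw [heq] at hX
    have h1 := (hX _ (le_max_left X Y)).2
    have h2 := (hY _ (le_max_right X Y)).1
    push_cast at h2
    linarith

theorem level_lt_level_of_lt {b₁ b₂ : ℝ} (hb : b₁ < b₂) {n : ℕ} (hn : 1 ≤ n) :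
    level b₁ n < level b₂ n := by
  obtain ⟨y, hy, h⟩ := (level_decays b₂ hn).exists_le_of_lt (isPhase_phase _ _)
    (isPhase_phase b₁ (level b₂ n)) le_rfl (a := b₂) (by rw [phase_self]; exact phase_pos hb)
  have hmem : level b₂ n ∈ crossing b₁ n := ⟨y, hb.le.trans hy, h⟩
  refine lt_of_le_of_ne (csInf_le (crossing_bddBelow b₁ hn) hmem) fun heq => ?_
  exact level_not_mem_crossing b₁ hn (heq ▸ hmem)

/-- The Prüfer amplitude attached to the angle `θ`, equal to one at `b`. -/
noncomputable def amplitude (b lam : ℝ) (θ : ℝ → ℝ) (x : ℝ) : ℝ :=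
  Real.exp (∫ t in b..x, (1 + t ^ 2 - lam) * (Real.sin (θ t) * Real.cos (θ t)))

theorem amplitude_self (b lam : ℝ) (θ : ℝ → ℝ) : amplitude b lam θ b = 1 := by
  simp [amplitude]

theorem amplitude_pos (b lam : ℝ) (θ : ℝ → ℝ) (x : ℝ) : 0 < amplitude b lam θ x :=
  Real.exp_pos _

theorem IsPhase.hasDerivAt_amplitude {lam : ℝ} {θ : ℝ → ℝ} (h : IsPhase lam θ) (b x : ℝ) :
    HasDerivAt (amplitude b lam θ) (amplitude b lam θ x *
      ((1 + x ^ 2 - lam) * (Real.sin (θ x) * Real.cos (θ x)))) x := by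
  have hθ := h.continuous
  have hm : Continuous fun t => (1 + t ^ 2 - lam) * (Real.sin (θ t) * Real.cos (θ t)) := by
    fun_prop
  exact (intervalIntegral.integral_hasDerivAt_right (hm.intervalIntegrable b x)
    (hm.stronglyMeasurableAtFilter _ _) hm.continuousAt).exp

theorem IsPhase.hasDerivAt_amplitude_mul_sin {lam : ℝ} {θ : ℝ → ℝ} (h : IsPhase lam θ)
    (b x : ℝ) : HasDerivAt (fun x => amplitude b lam θ x * Real.sin (θ x))
      (amplitude b lam θ x * Real.cos (θ x)) x := by
  refine ((h.hasDerivAt_amplitude b x).fun_mul (h x).sin).congr_deriv ?_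
  ring

theorem IsPhase.hasDerivAt_amplitude_mul_cos {lam : ℝ} {θ : ℝ → ℝ} (h : IsPhase lam θ)
    (b x : ℝ) : HasDerivAt (fun x => amplitude b lam θ x * Real.cos (θ x))
      ((x ^ 2 - lam) * (amplitude b lam θ x * Real.sin (θ x))) x := by
  refine ((h.hasDerivAt_amplitude b x).fun_mul (h x).cos).congr_deriv ?_
  linear_combination (amplitude b lam θ x * (1 + x ^ 2 - lam) * Real.sin (θ x)) *
    Real.sin_sq_add_cos_sq (θ x)

theorem eq_zero_of_linear_ode {E : Type*} [NormedAddCommGroup E] [NormedSpace ℝ E] {p : ℝ → ℝ}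
    (hp : Continuous p) {u v : ℝ → E} {a b : ℝ} (hu : ContinuousOn u (Icc a b))
    (hv : ContinuousOn v (Icc a b)) (hu' : ∀ t ∈ Ico a b, HasDerivWithinAt u (v t) (Ici t) t)
    (hv' : ∀ t ∈ Ico a b, HasDerivWithinAt v (p t • u t) (Ici t) t) (hua : u a = 0)
    (hva : v a = 0) : ∀ t ∈ Icc a b, u t = 0 := by
  obtain ⟨C, hC⟩ := (isCompact_Icc (a := a) (b := b)).exists_bound_of_continuousOn hp.continuousOn
  intro t ht
  have := eq_zero_of_abs_deriv_le_mul_abs_self_of_eq_zero_right (f := fun t => (u t, v t))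
    (f' := fun t => (v t, p t • u t)) (K := max 1 C) (hu.prodMk hv)
    (fun t ht => (hu' t ht).prodMk (hv' t ht)) (by simp [hua, hva]) (fun t ht => by
      rw [Prod.norm_def, Prod.norm_def]
      have h1 := le_max_left ‖u t‖ ‖v t‖
      have h2 := le_max_right ‖u t‖ ‖v t‖
      have h0 : 0 ≤ max ‖u t‖ ‖v t‖ := (norm_nonneg _).trans h1
      refine max_le ?_ ?_
      · calc ‖v t‖ ≤ 1 * max ‖u t‖ ‖v t‖ := by rwa [one_mul]
          _ ≤ _ := mul_le_mul_of_nonneg_right (le_max_left _ _) h0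
      · rw [norm_smul]
        exact mul_le_mul ((hC t (Ico_subset_Icc_self ht)).trans (le_max_right _ _)) h1
          (norm_nonneg _) (le_trans zero_le_one (le_max_left _ _))) t ht
  exact (Prod.mk.inj this).1

theorem hasDerivWithinAt_of_eq_primitive {f w : ℝ → ℂ} {c : ℂ} (hw : ContinuousOn w (Ici 0))
    (hf : ∀ x, 0 ≤ x → f x = c + ∫ t in (0 : ℝ)..x, w t) {t : ℝ} (ht : 0 ≤ t) :
    HasDerivWithinAt f (w t) (Ici t) t := by
  have hsub : Ioi t ⊆ Ici 0 := fun z hz => ht.trans (le_of_lt hz)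
  have hi : IntervalIntegrable w volume 0 t :=
    (hw.mono (by rw [uIcc_of_le ht]; exact Icc_subset_Ici_self)).intervalIntegrable
  have h := (intervalIntegral.integral_hasDerivWithinAt_right (s := Ici t) (t := Ioi t) hi
    ((hw.mono hsub).stronglyMeasurableAtFilter_nhdsWithin measurableSet_Ioi t)
    ((hw t ht).mono hsub)).const_add c
  exact h.congr (fun z hz => hf z (ht.trans hz)) (hf t ht)

theorem continuousOn_of_eq_primitive {f w : ℝ → ℂ} {c : ℂ}
    (hw : ∀ x, 0 ≤ x → IntervalIntegrable w volume 0 x)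
    (hf : ∀ x, 0 ≤ x → f x = c + ∫ t in (0 : ℝ)..x, w t) : ContinuousOn f (Ici 0) := by
  intro x hx
  have hx' : (0 : ℝ) ≤ x := hx
  have h1 : ContinuousOn (fun x => c + ∫ t in (0 : ℝ)..x, w t) (Icc 0 (x + 1)) := by
    have := intervalIntegral.continuousOn_primitive_interval' (hw (x + 1) (by linarith))
      (left_mem_uIcc)
    rw [uIcc_of_le (by linarith)] at this
    exact continuousOn_const.add this
  have h2 : ContinuousWithinAt f (Icc 0 (x + 1)) x :=
    (h1 x ⟨hx, by linarith⟩).congr (fun z hz => hf z hz.1) (hf x hx)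
  refine h2.mono_of_mem_nhdsWithin ?_
  rw [← Ici_inter_Iic]
  exact Filter.inter_mem self_mem_nhdsWithin (mem_nhdsWithin_of_mem_nhds (Iic_mem_nhds (by linarith)))

/-- The solution of `-φ'' + x² φ = lam φ` with `φ b = 0`, `φ' b = 1`. -/
noncomputable def dirichletSol (b lam x : ℝ) : ℝ :=
  amplitude b lam (phase b lam) x * Real.sin (phase b lam x)

/-- The derivative of `dirichletSol`. -/
noncomputable def dirichletDeriv (b lam x : ℝ) : ℝ :=
  amplitude b lam (phase b lam) x * Real.cos (phase b lam x)

theorem hasDerivAt_dirichletSol (b lam x : ℝ) :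
    HasDerivAt (dirichletSol b lam) (dirichletDeriv b lam x) x :=
  (isPhase_phase b lam).hasDerivAt_amplitude_mul_sin b x

theorem hasDerivAt_dirichletDeriv (b lam x : ℝ) :
    HasDerivAt (dirichletDeriv b lam) ((x ^ 2 - lam) * dirichletSol b lam x) x :=
  (isPhase_phase b lam).hasDerivAt_amplitude_mul_cos b x

theorem continuous_dirichletSol (b lam : ℝ) : Continuous (dirichletSol b lam) :=
  continuous_iff_continuousAt.2 fun x => (hasDerivAt_dirichletSol b lam x).continuousAt

theorem continuous_dirichletDeriv (b lam : ℝ) : Continuous (dirichletDeriv b lam) :=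
  continuous_iff_continuousAt.2 fun x => (hasDerivAt_dirichletDeriv b lam x).continuousAt

theorem dirichletSol_self (b lam : ℝ) : dirichletSol b lam b = 0 := by
  simp [dirichletSol, phase_self]

theorem dirichletDeriv_self (b lam : ℝ) : dirichletDeriv b lam b = 1 := by
  simp [dirichletDeriv, phase_self, amplitude_self]

theorem hasDerivAt_shift_dirichletSol (k lam x : ℝ) :
    HasDerivAt (fun x => (dirichletSol (-k) lam (x - k) : ℂ))
      (dirichletDeriv (-k) lam (x - k) : ℂ) x :=
  ((hasDerivAt_dirichletSol (-k) lam (x - k)).comp_sub_const x k).ofReal_comp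

theorem hasDerivAt_shift_dirichletDeriv (k lam x : ℝ) :
    HasDerivAt (fun x => (dirichletDeriv (-k) lam (x - k) : ℂ))
      ((((x - k) ^ 2 - lam) * dirichletSol (-k) lam (x - k) : ℝ) : ℂ) x :=
  ((hasDerivAt_dirichletDeriv (-k) lam (x - k)).comp_sub_const x k).ofReal_comp

theorem FiberOperator.exists_eq_mul_dirichletSol {k lam : ℝ} {u : ℝ → ℂ}
    (h : FiberOperator k u fun x => (lam : ℂ) * u x) :
    ∃ c : ℂ, ∀ x, 0 ≤ x → u x = c * dirichletSol (-k) lam (x - k) := by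
  obtain ⟨hu2, -, v, hu, hv⟩ := h
  have hui : ∀ x, 0 ≤ x → IntervalIntegrable u volume 0 x := by
    intro x hx
    rw [intervalIntegrable_iff_integrableOn_Ioc_of_le hx]
    exact (hu2.mono_measure (Measure.restrict_mono Ioc_subset_Ioi_self le_rfl)).integrable
      (by norm_num)
  have hgi : ∀ x, 0 ≤ x → IntervalIntegrable
      (fun t => (((t - k) ^ 2 : ℝ) : ℂ) * u t - (lam : ℂ) * u t) volume 0 x := fun x hx =>
    ((hui x hx).continuousOn_mul (by fun_prop)).sub ((hui x hx).const_mul _)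
  have hvc : ContinuousOn v (Ici 0) := continuousOn_of_eq_primitive hgi hv
  have hu0 : ∀ x, 0 ≤ x → u x = 0 + ∫ t in (0 : ℝ)..x, v t := fun x hx => by
    rw [zero_add]; exact hu x hx
  have huc : ContinuousOn u (Ici 0) := continuousOn_of_eq_primitive
    (fun x hx => (hvc.mono (by rw [uIcc_of_le hx]; exact Icc_subset_Ici_self)).intervalIntegrable)
    hu0
  have hud : ∀ t, 0 ≤ t → HasDerivWithinAt u (v t) (Ici t) t := fun t ht =>
    hasDerivWithinAt_of_eq_primitive hvc hu0 ht
  have hvd : ∀ t, 0 ≤ t → HasDerivWithinAt v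
      ((((t - k) ^ 2 : ℝ) : ℂ) * u t - (lam : ℂ) * u t) (Ici t) t := fun t ht =>
    hasDerivWithinAt_of_eq_primitive (by fun_prop) hv ht
  refine ⟨v 0, fun x hx => ?_⟩
  have hS := fun t => (hasDerivAt_shift_dirichletSol k lam t).const_mul (v 0)
  have hD := fun t => (hasDerivAt_shift_dirichletDeriv k lam t).const_mul (v 0)
  have := eq_zero_of_linear_ode (p := fun t => (t - k) ^ 2 - lam) (by fun_prop)
    (u := fun t => u t - v 0 * dirichletSol (-k) lam (t - k))
    (v := fun t => v t - v 0 * dirichletDeriv (-k) lam (t - k)) (a := 0) (b := x)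
    ((huc.mono Icc_subset_Ici_self).sub (fun t _ => (hS t).continuousAt.continuousWithinAt))
    ((hvc.mono Icc_subset_Ici_self).sub (fun t _ => (hD t).continuousAt.continuousWithinAt))
    (fun t ht => (hud t ht.1).fun_sub (hS t).hasDerivWithinAt)
    (fun t ht => ((hvd t ht.1).fun_sub (hD t).hasDerivWithinAt).congr_deriv (by
      rw [Complex.real_smul]; push_cast; ring))
    (by simp [hu 0 le_rfl, dirichletSol_self]) (by simp [dirichletDeriv_self]) x ⟨hx, le_rfl⟩
  exact sub_eq_zero.1 this

theorem sin_mul_cos_eq (s : ℝ) (n : ℕ) :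
    Real.sin s * Real.cos s = Real.sin (2 * (s - n * Real.pi)) / 2 := by
  have : 2 * (s - n * Real.pi) = 2 * s - n * (2 * Real.pi) := by ring
  rw [this, Real.sin_sub_nat_mul_two_pi, Real.sin_two_mul]
  ring

theorem not_integrableOn_sq_dirichletSol {b lam X : ℝ} {j : ℕ}
    (h : ∀ x, X ≤ x → j * Real.pi < phase b lam x ∧
      phase b lam x ≤ j * Real.pi + Real.pi / 2) (Y : ℝ) :
    ¬ IntegrableOn (fun x => dirichletSol b lam x ^ 2) (Ioi Y) := by
  intro hint
  have hpi := Real.pi_pos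
  have hmono : MonotoneOn (fun x => dirichletSol b lam x ^ 2) (Ici X) := by
    refine monotoneOn_of_deriv_nonneg (convex_Ici X)
      ((continuous_dirichletSol b lam).pow 2).continuousOn
      (fun x _ => ((hasDerivAt_dirichletSol b lam x).pow 2).differentiableAt.differentiableWithinAt)
      fun x hx => ?_
    have hx' : X ≤ x := interior_subset hx
    have hd := (hasDerivAt_dirichletSol b lam x).fun_pow 2
    rw [hd.deriv]
    have h1 : 0 ≤ Real.sin (phase b lam x) * Real.cos (phase b lam x) := by
      rw [sin_mul_cos_eq _ j]
      have := Real.sin_nonneg_of_nonneg_of_le_pi (x := 2 * (phase b lam x - j * Real.pi))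
        (by linarith [h x hx']) (by linarith [h x hx'])
      positivity
    have h2 : (2 : ℕ) * dirichletSol b lam x ^ (2 - 1) * dirichletDeriv b lam x
        = 2 * amplitude b lam (phase b lam) x ^ 2 *
          (Real.sin (phase b lam x) * Real.cos (phase b lam x)) := by
      simp [dirichletSol, dirichletDeriv]; ring
    rw [h2]
    positivity
  set Z := max X Y
  have hpos : 0 < dirichletSol b lam Z ^ 2 := by
    rw [dirichletSol, mul_pow, ← sin_sq_sub_int_mul_pi _ (j : ℤ)]
    have := amplitude_pos b lam (phase b lam) Z
    have hZ := h Z (le_max_left _ _)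
    have := Real.sin_pos_of_pos_of_lt_pi (x := phase b lam Z - ((j : ℤ) : ℝ) * Real.pi)
      (by push_cast; linarith) (by push_cast; linarith)
    positivity
  have h1 : IntegrableOn (fun _ : ℝ => dirichletSol b lam Z ^ 2) (Ioi Z) := by
    refine Integrable.mono' (hint.mono_set (Ioi_subset_Ioi (le_max_right X Y)))
      aestronglyMeasurable_const ?_
    filter_upwards [ae_restrict_mem measurableSet_Ioi] with x hx
    rw [Real.norm_of_nonneg hpos.le]
    exact hmono (mem_Ici.2 (le_max_left X Y)) (mem_Ici.2 ((le_max_left X Y).trans (le_of_lt hx)))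
      (le_of_lt hx)
  rw [integrableOn_const_iff] at h1
  simp at h1
  simp [h1] at hpos

theorem Decays.integrableOn_sq_dirichletSol {b lam : ℝ} {n : ℕ} (h : Decays (phase b lam) n) :
    IntegrableOn (fun x => dirichletSol b lam x ^ 2) (Ioi b) := by
  obtain ⟨X₀, hX₀⟩ := h
  obtain ⟨X₁, hbX, -, hX₁⟩ := exists_forall_lt_sq (lam + 1) b
  set X := max X₀ X₁ with hX
  have hbX : b ≤ X := hbX.trans (le_max_right _ _)
  have hS := continuous_dirichletSol b lam
  have hD := continuous_dirichletDeriv b lam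
  have hprod : ∀ x, HasDerivAt (fun x => dirichletSol b lam x * dirichletDeriv b lam x)
      (dirichletDeriv b lam x * dirichletDeriv b lam x +
        dirichletSol b lam x * ((x ^ 2 - lam) * dirichletSol b lam x)) x := fun x =>
    (hasDerivAt_dirichletSol b lam x).fun_mul (hasDerivAt_dirichletDeriv b lam x)
  have hneg : ∀ x, X ≤ x → dirichletSol b lam x * dirichletDeriv b lam x ≤ 0 := by
    intro x hx
    have h1 := hX₀ x ((le_max_left _ _).trans hx)
    have h2 : Real.sin (phase b lam x) * Real.cos (phase b lam x) ≤ 0 := by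
      rw [sin_mul_cos_eq _ n]
      have := Real.sin_nonpos_of_nonpos_of_neg_pi_le (x := 2 * (phase b lam x - n * Real.pi))
        (by linarith) (by linarith)
      linarith
    have h3 : dirichletSol b lam x * dirichletDeriv b lam x
        = amplitude b lam (phase b lam) x ^ 2 *
          (Real.sin (phase b lam x) * Real.cos (phase b lam x)) := by
      simp [dirichletSol, dirichletDeriv]; ring
    rw [h3]
    exact mul_nonpos_of_nonneg_of_nonpos (sq_nonneg _) h2
  have htail : IntegrableOn (fun x => dirichletSol b lam x ^ 2) (Ioi X) := by
    refine integrableOn_Ioi_of_intervalIntegral_norm_bounded (l := Filter.atTop) (b := id)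
      (-(dirichletSol b lam X * dirichletDeriv b lam X)) X
      (fun i => ((hS.pow 2).integrableOn_Icc).mono_set Ioc_subset_Icc_self) Filter.tendsto_id ?_
    filter_upwards [Filter.eventually_ge_atTop X] with Y hY
    have hc : Continuous fun x => dirichletDeriv b lam x * dirichletDeriv b lam x +
        dirichletSol b lam x * ((x ^ 2 - lam) * dirichletSol b lam x) := by fun_prop
    calc ∫ x in X..id Y, ‖dirichletSol b lam x ^ 2‖
        ≤ ∫ x in X..Y, (dirichletDeriv b lam x * dirichletDeriv b lam x +
        dirichletSol b lam x * ((x ^ 2 - lam) * dirichletSol b lam x)) := by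
          refine intervalIntegral.integral_mono_on hY
            ((hS.pow 2).norm.intervalIntegrable _ _) (hc.intervalIntegrable _ _) fun x hx => ?_
          rw [Real.norm_of_nonneg (sq_nonneg _)]
          have := hX₁ x ((le_max_right _ _).trans hx.1)
          nlinarith [sq_nonneg (dirichletDeriv b lam x), sq_nonneg (dirichletSol b lam x)]
      _ = dirichletSol b lam Y * dirichletDeriv b lam Y -
          dirichletSol b lam X * dirichletDeriv b lam X :=
        intervalIntegral.integral_eq_sub_of_hasDerivAt (fun x _ => hprod x)
          (hc.intervalIntegrable _ _)
      _ ≤ _ := by linarith [hneg Y hY]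
  rw [← Ioc_union_Ioi_eq_Ioi hbX]
  exact (((hS.pow 2).integrableOn_Icc).mono_set Ioc_subset_Icc_self).union htail

theorem IsNormalizedEigenfunction.exists_decays {k lam : ℝ} {u : ℝ → ℂ}
    (h : IsNormalizedEigenfunction k lam u) :
    ∃ n : ℕ, 1 ≤ n ∧ Decays (phase (-k) lam) n := by
  refine (phase_decays_or (-k) lam).resolve_right ?_
  rintro ⟨j, X, hX⟩
  obtain ⟨hop, hnorm⟩ := h
  obtain ⟨c, hc⟩ := hop.exists_eq_mul_dirichletSol
  have hc0 : c ≠ 0 := by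
    rintro rfl
    rw [setIntegral_congr_fun (g := fun _ => (0 : ℝ)) measurableSet_Ioi
      fun x hx => by simp [hc x (le_of_lt hx)]] at hnorm
    simp at hnorm
  have hint : IntegrableOn (fun x => ‖u x‖ ^ 2) (Ioi 0) :=
    (memLp_two_iff_integrable_sq_norm hop.1.1).1 hop.1
  have hint2 : IntegrableOn (fun x => dirichletSol (-k) lam (x - k) ^ 2) (Ioi 0) := by
    refine IntegrableOn.congr_fun (hint.const_mul (‖c‖ ^ 2)⁻¹) (fun x hx => ?_) measurableSet_Ioi
    have : ‖c‖ ≠ 0 := norm_ne_zero_iff.2 hc0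
    simp only [hc x (le_of_lt hx), norm_mul, Complex.norm_real, mul_pow, Real.norm_eq_abs, sq_abs]
    field_simp
  refine not_integrableOn_sq_dirichletSol hX (-k) ?_
  rw [← (measurePreserving_sub_right volume k).integrableOn_comp_preimage
    (MeasurableEquiv.subRight k).measurableEmbedding]
  simpa [Function.comp_def] using hint2

theorem Decays.mem_eigenvalues {k lam : ℝ} {n : ℕ} (h : Decays (phase (-k) lam) n) :
    lam ∈ eigenvalues k := by
  set φ : ℝ → ℝ := fun x => dirichletSol (-k) lam (x - k) with hφ
  have hφc : Continuous φ := (continuous_dirichletSol _ _).comp (by fun_prop)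
  have hint : IntegrableOn (fun x => φ x ^ 2) (Ioi 0) := by
    have := h.integrableOn_sq_dirichletSol
    rw [← (measurePreserving_sub_right volume k).integrableOn_comp_preimage
      (MeasurableEquiv.subRight k).measurableEmbedding] at this
    simpa [Function.comp_def] using this
  set N : ℝ := ∫ x in Ioi (0 : ℝ), φ x ^ 2 with hN
  have hNpos : 0 < N := by
    have hne : ∃ x ∈ Ioi (0 : ℝ), φ x ≠ 0 := by
      by_contra! h0
      have hd := hasDerivAt_shift_dirichletSol k lam 0
      have h1 := hd.hasDerivWithinAt (s := Ioi 0)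
      have h2 : HasDerivWithinAt (fun x => (dirichletSol (-k) lam (x - k) : ℂ)) 0 (Ioi 0) 0 :=
        (hasDerivWithinAt_const (0 : ℝ) (Ioi 0) (0 : ℂ)).congr
          (fun x hx => by simpa [hφ] using h0 x hx) (by simp [dirichletSol_self])
      have h3 := (uniqueDiffWithinAt_Ioi (0 : ℝ)).eq_deriv _ h1 h2
      simp [dirichletDeriv_self] at h3
    obtain ⟨x, hx, hne⟩ := hne
    rw [hN, setIntegral_pos_iff_support_of_nonneg_ae
      (Filter.Eventually.of_forall fun x => sq_nonneg _) hint]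
    have hopen : IsOpen (Function.support (fun x => φ x ^ 2) ∩ Ioi 0) :=
      ((hφc.pow 2).isOpen_support).inter isOpen_Ioi
    exact hopen.measure_pos volume ⟨x, by simpa using hne, hx⟩
  set c : ℝ := (Real.sqrt N)⁻¹ with hc
  have hmem : MemLp (fun x => ((c : ℂ) * φ x)) 2 (volume.restrict (Ioi 0)) := by
    refine MemLp.const_mul ?_ _
    rw [memLp_two_iff_integrable_sq_norm
      (by exact (Complex.continuous_ofReal.comp hφc).aestronglyMeasurable)]
    simpa [IntegrableOn] using hint
  refine ⟨fun x => (c : ℂ) * φ x, ⟨hmem, hmem.const_mul _,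
    fun x => (c : ℂ) * dirichletDeriv (-k) lam (x - k), fun x hx => ?_, fun x hx => ?_⟩, ?_⟩
  · have hcont : Continuous fun x => (c : ℂ) * dirichletDeriv (-k) lam (x - k) := by
      have := continuous_dirichletDeriv (-k) lam
      fun_prop
    rw [intervalIntegral.integral_eq_sub_of_hasDerivAt
      (fun t _ => (hasDerivAt_shift_dirichletSol k lam t).const_mul (c : ℂ))
      (hcont.intervalIntegrable _ _)]
    simp [hφ, dirichletSol_self]
  · have hcont : Continuous fun x : ℝ =>
        (c : ℂ) * ((((x - k) ^ 2 - lam) * dirichletSol (-k) lam (x - k) : ℝ) : ℂ) := by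
      have := continuous_dirichletSol (-k) lam
      fun_prop
    have := intervalIntegral.integral_eq_sub_of_hasDerivAt (a := 0) (b := x)
      (fun t _ => (hasDerivAt_shift_dirichletDeriv k lam t).const_mul (c : ℂ))
      (hcont.intervalIntegrable _ _)
    have hcongr : (∫ t in (0 : ℝ)..x, ((((t - k) ^ 2 : ℝ) : ℂ) * ((c : ℂ) * φ t)
        - (lam : ℂ) * ((c : ℂ) * φ t))) = ∫ t in (0 : ℝ)..x,
          (c : ℂ) * ((((t - k) ^ 2 - lam) * dirichletSol (-k) lam (t - k) : ℝ) : ℂ) := by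
      refine intervalIntegral.integral_congr fun t _ => ?_
      simp only [hφ]
      push_cast
      ring
    rw [hcongr, this]
    ring
  · have : ∀ x, ‖(c : ℂ) * φ x‖ ^ 2 = c ^ 2 * φ x ^ 2 := fun x => by
      simp [mul_pow]
    simp only [this]
    rw [integral_const_mul, ← hN, hc, inv_pow, Real.sq_sqrt hNpos.le, inv_mul_cancel₀ hNpos.ne']

theorem eigenvalues_eq_range (k : ℝ) :
    eigenvalues k = range fun i : ℕ => level (-k) (i + 1) := by
  ext lam
  constructor
  · rintro ⟨u, hu⟩
    obtain ⟨n, hn, h⟩ := hu.exists_decays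
    refine ⟨n - 1, ?_⟩
    simp only [Nat.sub_add_cancel hn]
    exact (eq_level_of_decays hn h).symm
  · rintro ⟨i, rfl⟩
    exact (level_decays (-k) (n := i + 1) (by omega)).mem_eigenvalues

theorem sInf_range_encard_eq {g : ℕ → ℝ} (hg : StrictMono g) {n : ℕ} (hn : 1 ≤ n) :
    sInf {lam | lam ∈ range g ∧ (n : ℕ∞) ≤ (range g ∩ Iic lam).encard} = g (n - 1) := by
  have hcount : ∀ m, (range g ∩ Iic (g m)).encard = ((m + 1 : ℕ) : ℕ∞) := by
    intro m
    have : range g ∩ Iic (g m) = g '' (Finset.range (m + 1) : Finset ℕ) := by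
      ext y
      constructor
      · rintro ⟨⟨i, rfl⟩, hi⟩
        have := hg.le_iff_le.1 hi
        exact ⟨i, by simp; omega, rfl⟩
      · rintro ⟨i, hi, rfl⟩
        simp at hi
        exact ⟨⟨i, rfl⟩, hg.monotone (by omega)⟩
    rw [this, hg.injective.encard_image, encard_coe_eq_coe_finsetCard, Finset.card_range]
  refine IsLeast.csInf_eq ⟨⟨⟨_, rfl⟩, ?_⟩, ?_⟩
  · rw [hcount]
    exact_mod_cast (by omega : n ≤ n - 1 + 1)
  · rintro y ⟨⟨m, rfl⟩, hm⟩
    rw [hcount] at hm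
    have : n ≤ m + 1 := by exact_mod_cast hm
    exact hg.monotone (by omega)

theorem bandFun_eq_level {n : ℕ} (hn : 1 ≤ n) (k : ℝ) : bandFun n k = level (-k) n := by
  have hmono : StrictMono fun i : ℕ => level (-k) (i + 1) :=
    strictMono_nat_of_lt_succ fun i => level_lt_level_succ (-k) (by omega)
  rw [bandFun, eigenvalues_eq_range, sInf_range_encard_eq hmono hn]
  simp only [Nat.sub_add_cancel hn]

theorem bandFun_strictAnti {n : ℕ} (hn : 1 ≤ n) : StrictAnti (bandFun n) := fun k₁ k₂ h => by
  rw [bandFun_eq_level hn, bandFun_eq_level hn]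
  exact level_lt_level_of_lt (neg_lt_neg h) hn

open Polynomial in
theorem exists_hermite_polynomial (m : ℕ) : ∃ p : ℝ[X], p ≠ 0 ∧ p.natDegree ≤ m ∧
    derivative (derivative p) = 2 * X * derivative p - C (2 * (m : ℝ)) * p := by
  induction m with
  | zero => exact ⟨1, one_ne_zero, by simp, by simp⟩
  | succ m ih =>
    obtain ⟨p, hp0, hdeg, hode⟩ := ih
    have hd : derivative (2 * X * p - derivative p) = C (2 * ((m : ℝ) + 1)) * p := by
      simp only [derivative_sub, derivative_mul, hode, derivative_X]
      simp
      rw [show (C (2 : ℝ) : ℝ[X]) = 2 from rfl]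
      ring
    refine ⟨2 * X * p - derivative p, fun h => ?_, ?_, ?_⟩
    · rw [h, derivative_zero] at hd
      have hC : C (2 * ((m : ℝ) + 1)) ≠ 0 := by
        rw [Ne, C_eq_zero]
        positivity
      exact (mul_ne_zero hC hp0) hd.symm
    · refine (natDegree_sub_le _ _).trans (max_le ?_ ?_)
      · have h2 : (2 * X * p : ℝ[X]) = C 2 * (X * p) := by
          rw [mul_assoc]; rfl
        rw [h2]
        refine (natDegree_C_mul_le _ _).trans (natDegree_mul_le.trans ?_)
        rw [natDegree_X]
        omega
      · exact (natDegree_derivative_le p).trans (by omega)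
    · rw [hd, derivative_mul, derivative_C]
      push_cast
      ring

/-- The oscillator equation at the Landau level has a real solution with fewer than `n` zeros. -/
theorem exists_hermite_solution {n : ℕ} (hn : 1 ≤ n) : ∃ h h' : ℝ → ℝ,
    (∀ x, HasDerivAt h (h' x) x) ∧ (∀ x, HasDerivAt h' ((x ^ 2 - landau n) * h x) x) ∧
    ∀ s : Finset ℝ, (∀ x ∈ s, h x = 0) → s.card < n := by
  obtain ⟨p, hp0, hdeg, hode⟩ := exists_hermite_polynomial (n - 1)
  have hG : ∀ x : ℝ, HasDerivAt (fun x : ℝ => Real.exp (-(x ^ 2 / 2)))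
      (Real.exp (-(x ^ 2 / 2)) * -x) x := fun x => by
    refine (((hasDerivAt_id x).fun_pow 2).div_const 2).fun_neg.exp.congr_deriv ?_
    simp
  refine ⟨fun x => p.eval x * Real.exp (-(x ^ 2 / 2)),
    fun x => (p.derivative.eval x - x * p.eval x) * Real.exp (-(x ^ 2 / 2)),
    fun x => ((p.hasDerivAt x).fun_mul (hG x)).congr_deriv (by ring), fun x => ?_, ?_⟩
  · refine ((((p.derivative.hasDerivAt x).fun_sub
      ((hasDerivAt_id x).fun_mul (p.hasDerivAt x)))).fun_mul (hG x)).congr_deriv ?_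
    have h1 := congrArg (Polynomial.eval x) hode
    have h2 : ((n - 1 : ℕ) : ℝ) = n - 1 := by push_cast [hn]; ring
    simp [h2] at h1
    simp only [id, landau]
    rw [h1]
    ring
  · intro s hs
    have hsub : s ⊆ p.roots.toFinset := fun x hx => by
      rw [Multiset.mem_toFinset, Polynomial.mem_roots hp0]
      have := hs x hx
      simpa [(Real.exp_pos _).ne'] using this
    have h1 := (Finset.card_le_card hsub).trans p.roots.toFinset_card_le
    have h2 := p.card_roots'
    omega

theorem exists_polar (p q : ℝ) : ∃ r s : ℝ, 0 < s ∧ s ≤ Real.pi ∧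
    p = r * Real.sin s ∧ q = r * Real.cos s := by
  by_cases hp : p = 0
  · exact ⟨-q, Real.pi, Real.pi_pos, le_rfl, by simp [hp], by simp⟩
  · have h1 := Real.arctan_lt_pi_div_two (q / p)
    have h2 := Real.neg_pi_div_two_lt_arctan (q / p)
    have h3 : (0 : ℝ) < Real.sqrt (1 + (q / p) ^ 2) := by positivity
    refine ⟨p * Real.sqrt (1 + (q / p) ^ 2), Real.pi / 2 - Real.arctan (q / p), by linarith,
      by linarith, ?_, ?_⟩
    · rw [Real.sin_pi_div_two_sub, Real.cos_arctan]
      field_simp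
    · rw [Real.cos_pi_div_two_sub, Real.sin_arctan]
      field_simp

/-- At the Landau level there is an angle, positive at `b`, that never reaches `n π`. -/
theorem exists_phase_landau {n : ℕ} (hn : 1 ≤ n) (b : ℝ) : ∃ η : ℝ → ℝ,
    IsPhase (landau n) η ∧ 0 < η b ∧ ∀ x, b < x → η x < n * Real.pi := by
  obtain ⟨h, h', hd, hd', hcard⟩ := exists_hermite_solution hn
  obtain ⟨r, s, hs0, hspi, hr, hr'⟩ := exists_polar (h b) (h' b)
  obtain ⟨η, hη0, hη⟩ := exists_isPhase (landau n) b s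
  refine ⟨η, hη, hη0 ▸ hs0, fun x hx => ?_⟩
  by_contra! hge
  have hpi := Real.pi_pos
  have hS := fun t => (hη.hasDerivAt_amplitude_mul_sin b t).const_mul r
  have hC := fun t => (hη.hasDerivAt_amplitude_mul_cos b t).const_mul r
  have heq : ∀ t, b ≤ t → h t = r * (amplitude b (landau n) η t * Real.sin (η t)) := by
    intro t ht
    have := eq_zero_of_linear_ode (p := fun t => t ^ 2 - landau n) (by fun_prop)
      (u := fun t => h t - r * (amplitude b (landau n) η t * Real.sin (η t)))
      (v := fun t => h' t - r * (amplitude b (landau n) η t * Real.cos (η t))) (a := b) (b := t)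
      (fun t _ => ((hd t).fun_sub (hS t)).continuousAt.continuousWithinAt)
      (fun t _ => ((hd' t).fun_sub (hC t)).continuousAt.continuousWithinAt)
      (fun t _ => ((hd t).fun_sub (hS t)).hasDerivWithinAt)
      (fun t _ => (((hd' t).fun_sub (hC t)).congr_deriv (by
        rw [smul_eq_mul]; ring)).hasDerivWithinAt)
      (by simp only [amplitude_self, hη0, one_mul, hr, sub_self])
      (by simp only [amplitude_self, hη0, one_mul, hr', sub_self]) t ⟨ht, le_rfl⟩
    exact sub_eq_zero.1 this
  have hex : ∀ j : ℕ, 1 ≤ j → j ≤ n → ∃ t, b ≤ t ∧ η t = j * Real.pi := by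
    intro j h1 h2
    have h1' : (1 : ℝ) ≤ j := by exact_mod_cast h1
    have h2' : (j : ℝ) ≤ n := by exact_mod_cast h2
    obtain ⟨t, ht, hte⟩ := intermediate_value_Icc hx.le hη.continuous.continuousOn
      (show j * Real.pi ∈ Icc (η b) (η x) from ⟨by rw [hη0]; nlinarith, by nlinarith⟩)
    exact ⟨t, ht.1, hte⟩
  choose! t ht hte using hex
  have hinj : InjOn t (Finset.Icc 1 n : Finset ℕ) := by
    intro i hi j hj hij
    rw [Finset.coe_Icc] at hi hj
    have := hte i hi.1 hi.2
    rw [hij, hte j hj.1 hj.2] at this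
    exact_mod_cast (mul_right_cancel₀ hpi.ne' this).symm
  have := hcard ((Finset.Icc 1 n).image t) fun y hy => by
    obtain ⟨j, hj, rfl⟩ := Finset.mem_image.1 hy
    rw [Finset.mem_Icc] at hj
    rw [heq _ (ht j hj.1 hj.2), hte j hj.1 hj.2, Real.sin_nat_mul_pi]
    simp
  rw [Finset.card_image_of_injOn hinj, Nat.card_Icc] at this
  omega

theorem landau_lt_level {n : ℕ} (hn : 1 ≤ n) (b : ℝ) : landau n < level b n := by
  obtain ⟨η, hη, hpos, hlt⟩ := exists_phase_landau hn b
  have hpi := Real.pi_pos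
  have hn' : (1 : ℝ) ≤ n := by exact_mod_cast hn
  have hθ := isPhase_phase b (landau n)
  have hb : phase b (landau n) b < η b := by rwa [phase_self]
  by_contra! hle
  rcases hle.eq_or_lt with heq | hl
  · have hdec := level_decays b hn
    rw [heq] at hdec
    obtain ⟨y, hy, hny⟩ := hdec.exists_le_of_lt hθ hη le_rfl hb
    have h1 := hη.lt_of_int_mul_pi_le (j := (n : ℤ)) (a := y) (x := y + 1)
      (by simpa using hny) (by linarith)
    push_cast at h1
    linarith [hlt (y + 1) (by linarith)]
  · obtain ⟨y, hy, hny⟩ := mem_crossing_of_level_lt hl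
    have h1 := hθ.lt_of_lt hη le_rfl hb hy
    rcases hy.eq_or_lt with e | e
    · rw [← e, phase_self] at hny
      nlinarith
    · linarith [hlt y e]

theorem landau_lt_bandFun {n : ℕ} (hn : 1 ≤ n) (k : ℝ) : landau n < bandFun n k := by
  rw [bandFun_eq_level hn]
  exact landau_lt_level hn _

theorem bandInv_bandFun {n : ℕ} (hn : 1 ≤ n) (k : ℝ) : bandInv n (bandFun n k) = k :=
  Function.leftInverse_invFun (bandFun_strictAnti hn).injective k

theorem wWeight_mul_fourierCoefficient {u : ℕ → ℝ → ℝ → ℂ} {n : ℕ} (hn : 1 ≤ n) (α : ℝ)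
    (f : ℝ × ℝ → ℂ) (k : ℝ) :
    (wWeight n α k : ℂ) * fourierCoefficient u n f k =
      ((bandFun n k - landau n) ^ (-α) : ℝ) * weightedCoefficient u n f (bandFun n k) := by
  rw [wWeight, weightedCoefficient, muWeight, bandInv_bandFun hn,
    abs_of_pos (sub_pos.2 (landau_lt_bandFun hn k))]
  push_cast
  ring

theorem IsHolderSpace.exists_norm_rpow_mul_le {α a : ℝ} (hα : 0 ≤ α) {g : ℝ → ℂ}
    (hg : IsHolderSpace α (Ici a) g) (h0 : g a = 0) :
    ∃ C : ℝ, ∀ x, a < x → ‖(((x - a) ^ (-α) : ℝ) : ℂ) * g x‖ ≤ C := by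
  obtain ⟨-, -, C, hC⟩ := hg
  refine ⟨C, fun x hx => ?_⟩
  have hpos : 0 < x - a := sub_pos.2 hx
  have h1 := hC.dist_le (mem_Ici.2 hx.le) (mem_Ici.2 le_rfl)
  rw [h0, dist_zero_right, Real.dist_eq, abs_of_pos hpos, Real.coe_toNNReal α hα] at h1
  rw [norm_mul, Complex.norm_real, Real.norm_of_nonneg (by positivity)]
  calc (x - a) ^ (-α) * ‖g x‖ ≤ (x - a) ^ (-α) * (C * (x - a) ^ α) := by gcongr
    _ = C := by
      rw [Real.rpow_neg hpos.le]
      field_simp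

end HalfPlane

theorem proposition3p1 (u : ℕ → ℝ → ℝ → ℂ) (hu : HalfPlane.IsEigenfunctionFamily u)
    (n : ℕ) (hn : 1 ≤ n) (s : ℝ) (hs : 1 / 2 < s)
    (α : ℝ) (hα0 : 0 ≤ α) (hα : α < min 1 (s - 1 / 2))
    (f : ℝ × ℝ → ℂ) (hf : f ∈ HalfPlane.absorptionSpace u n s α) :
    MemLp (fun k : ℝ => (HalfPlane.wWeight n α k : ℂ) * HalfPlane.fourierCoefficient u n f k)
        ⊤ volume ∧
      ∃ C : ℝ, ∀ k : ℝ,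
        ‖(HalfPlane.wWeight n α k : ℂ) * HalfPlane.fourierCoefficient u n f k‖ ≤ C := by
  obtain ⟨-, -, g, hg, hgH, hg0⟩ := hf
  have hgt := HalfPlane.landau_lt_bandFun hn
  have heq : ∀ k, (HalfPlane.wWeight n α k : ℂ) * HalfPlane.fourierCoefficient u n f k =
      ((HalfPlane.bandFun n k - HalfPlane.landau n) ^ (-α) : ℝ) * g (HalfPlane.bandFun n k) :=
    fun k => by rw [HalfPlane.wWeight_mul_fourierCoefficient hn, hg _ (hgt k)]
  obtain ⟨C, hC⟩ := hgH.exists_norm_rpow_mul_le hα0 hg0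
  have hbound : ∀ k, ‖(HalfPlane.wWeight n α k : ℂ) *
      HalfPlane.fourierCoefficient u n f k‖ ≤ C := fun k => by
    rw [heq]
    exact hC _ (hgt k)
  refine ⟨memLp_top_of_bound ?_ C (Filter.Eventually.of_forall hbound), C, hbound⟩
  have hband : Measurable (HalfPlane.bandFun n) :=
    (HalfPlane.bandFun_strictAnti hn).antitone.measurable
  have hgm : Measurable fun k => g (HalfPlane.bandFun n k) := by
    have h1 : Measurable ((Ici (HalfPlane.landau n)).domRestrict g) := hgH.1.domRestrict.measurable
    exact h1.comp (hband.subtype_mk (h := fun k => mem_Ici.2 (hgt k).le))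
  simp only [heq]
  exact ((Complex.measurable_ofReal.comp ((hband.sub_const _).pow_const _)).mul
    hgm).aestronglyMeasurable
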